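/- Let $M,N\ge 0$ be integers, let $\vec a_1,\dots,\vec a_N$ be nonzero vectors spanning $\mathbb R^M$, and let $1\le p_j\le\infty$ for $j=1,\dots,N$; write $\vec p=(1/p_1,\dots,1/p_N)$. Define, as elements of $[0,\infty]$, $$D(\vec p)=\sup\left\{\frac{\int_{\mathbb R^M}\prod_{j=1}^N f_j(\vec a_j\cdot x)\,dx}{\prod_{j=1}^N\|f_j\|_{L^{p_j}(\mathbb R)}}\ :\ f_j\in L^{p_j}(\mathbb R),\ f_j\ge 0,\ \|f_j\|_{p_j}\neq 0,\ j=1,\dots,N\right\},$$ and let $D_{\mathcal G}(\vec p)$ be the same supremum restricted to centered Gaussian functions $f_j=g_j$, that is, $g_j(y)=c_je^{-(s_jy)^2/2}$ with $c_j>0$ and $s_j>0$. Suppose that the Gaussian variational problem has a maximizer: there are $0<s_j<\infty$ such that, with $g_j(y)=e^{-(s_jy)^2/2}$, $$\int_{\mathbb R^M}\prod_{j=1}^N g_j(\vec a_j\cdot x)\,dx=D_{\mathcal G}(\vec p)\prod_{j=1}^N\|g_j\|_{p_j}.$$ Then $D(\vec p)=D_{\mathcal G}(\vec p)$. -/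

import Mathlib

open MeasureTheory
open scoped ENNReal

noncomputable section

namespace BrascampLieb

/-- The integral over `ℝ^M` of `∏ j, f j (a j · x)` with respect to Lebesgue measure, as an element
of `[0, ∞]` (it is only used for nonnegative `f j`). -/
def productIntegral {M N : ℕ} (a : Fin N → EuclideanSpace ℝ (Fin M)) (f : Fin N → ℝ → ℝ) : ℝ≥0∞ :=
  ∫⁻ x : EuclideanSpace ℝ (Fin M), ENNReal.ofReal (∏ j, f j (inner ℝ (a j) x))

/-- The product of the norms `‖f j‖_{p j}` in `L^{p j}(ℝ)`. -/
def productNorm {N : ℕ} (p : Fin N → ℝ≥0∞) (f : Fin N → ℝ → ℝ) : ℝ≥0∞ :=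
  ∏ j, eLpNorm (f j) (p j) volume

/-- `D(p)`: the supremum of `∫ ∏ f_j (a_j · x) dx / ∏ ‖f_j‖_{p_j}` over all nonnegative
`f_j ∈ L^{p_j}(ℝ)` of nonzero norm (so that the quotient makes sense). -/
def bestConstant {M N : ℕ} (a : Fin N → EuclideanSpace ℝ (Fin M)) (p : Fin N → ℝ≥0∞) : ℝ≥0∞ :=
  sSup {r : ℝ≥0∞ | ∃ f : Fin N → ℝ → ℝ,
    (∀ j, (∀ y, 0 ≤ f j y) ∧ MemLp (f j) (p j) volume ∧ eLpNorm (f j) (p j) volume ≠ 0) ∧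
    r = productIntegral a f / productNorm p f}

/-- The centered Gaussian function `y ↦ c * exp (-(s y)² / 2)`. -/
def gaussian (c s : ℝ) (y : ℝ) : ℝ := c * Real.exp (-(s * y) ^ 2 / 2)

/-- The class of (nonnegative, nonzero) centered Gaussian functions on `ℝ`. -/
def IsCenteredGaussian (g : ℝ → ℝ) : Prop := ∃ c s : ℝ, 0 < c ∧ 0 < s ∧ g = gaussian c s

/-- `D_G(p)`: the same supremum, taken over centered Gaussian functions only. -/
def gaussianConstant {M N : ℕ} (a : Fin N → EuclideanSpace ℝ (Fin M)) (p : Fin N → ℝ≥0∞) : ℝ≥0∞ :=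
  sSup {r : ℝ≥0∞ | ∃ g : Fin N → ℝ → ℝ, (∀ j, IsCenteredGaussian (g j)) ∧
    r = productIntegral a g / productNorm p g}

/-- The Gaussian variational problem has a maximizer: there are `0 < s_j < ∞` such that the
Gaussian functions `exp (-(s_j y)² / 2)` attain the supremum `D_G(p)`. -/
def HasGaussianMaximizer {M N : ℕ} (a : Fin N → EuclideanSpace ℝ (Fin M))
    (p : Fin N → ℝ≥0∞) : Prop :=
  ∃ s : Fin N → ℝ, (∀ j, 0 < s j) ∧
    productIntegral a (fun j => gaussian 1 (s j)) =
      gaussianConstant a p * productNorm p (fun j => gaussian 1 (s j))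

end BrascampLieb

end

/-! The proof is by mass transport. Let `g j = exp (-(s j y)² / 2)` be the maximizing Gaussians and
`A = ∑ s_j² a_j ⊗ a_j`. For continuous positive `h j`, let `T j` be the increasing map carrying the
density `h_j^{p_j}` to `g_j^{p_j}`, both normalized. Up to the norms, `h_j = (T_j')^{1/p_j} · g_j ∘
T_j`. Glue these maps into `Θ x = A⁻¹ ∑ s_j² T_j(a_j · x) a_j`, which is injective.

Two inequalities compare the integrands. Testing maximality against the Gaussians with parameters
`s_j √r_j` gives `det A · ∏ r_j^{1/p_j} ≤ det (∑ s_j² r_j a_j ⊗ a_j)`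
(`det_frameOperator_mul_prod_le`). With `r_j = T_j'` this bounds `∏ (T_j')^{1/p_j}` by the Jacobian
of `Θ`. Least squares (`inner_frameOperator_le`) gives `∏ g_j(T_j(a_j · x)) ≤ ∏ g_j(a_j · Θ x)`.
Changing variables by `Θ` yields the bound for such `h`.

General `f j` follow by density and Fatou's lemma. An exponent `∞` is excluded, because flattening
that Gaussian would increase the integral at no cost in norm. -/

noncomputable section

namespace BrascampLieb

/-! ### Frame operators: positivity, determinants, least squares. -/

section LinearAlgebra

variable {ι E : Type*} [Fintype ι] [NormedAddCommGroup E] [InnerProductSpace ℝ E]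

/-- The weighted frame operator `∑ j, w j • (a j ⊗ a j)`. -/
def frameOperator (a : ι → E) (w : ι → ℝ) : E →L[ℝ] E :=
  ∑ j, w j • InnerProductSpace.rankOne ℝ (a j) (a j)

theorem frameOperator_apply (a : ι → E) (w : ι → ℝ) (x : E) :
    frameOperator a w x = ∑ j, (w j * inner ℝ (a j) x) • a j := by
  simp [frameOperator, smul_smul]

theorem inner_frameOperator (a : ι → E) (w : ι → ℝ) (x y : E) :
    inner ℝ x (frameOperator a w y) = ∑ j, w j * (inner ℝ (a j) x * inner ℝ (a j) y) := by
  simp only [frameOperator_apply, inner_sum, inner_smul_right, real_inner_comm x]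
  exact Finset.sum_congr rfl fun j _ => by ring

theorem inner_frameOperator_self (a : ι → E) (w : ι → ℝ) (x : E) :
    inner ℝ x (frameOperator a w x) = ∑ j, w j * inner ℝ (a j) x ^ 2 := by
  simp only [inner_frameOperator, sq]

theorem frameOperator_isPositive (a : ι → E) {w : ι → ℝ} (hw : ∀ j, 0 ≤ w j) :
    (frameOperator a w : E →ₗ[ℝ] E).IsPositive := by
  refine (LinearMap.isPositive_iff _).2 ⟨fun x y => ?_, fun x => ?_⟩
  · rw [ContinuousLinearMap.coe_coe, real_inner_comm, inner_frameOperator, inner_frameOperator]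
    exact Finset.sum_congr rfl fun j _ => by ring
  · rw [ContinuousLinearMap.coe_coe, real_inner_comm, inner_frameOperator_self]
    exact Finset.sum_nonneg fun j _ => mul_nonneg (hw j) (sq_nonneg _)

theorem eq_zero_of_forall_inner_eq_zero {ι E : Type*} [NormedAddCommGroup E]
    [InnerProductSpace ℝ E] {a : ι → E} (ha : Submodule.span ℝ (Set.range a) = ⊤)
    {x : E} (hx : ∀ j, inner ℝ (a j) x = 0) : x = 0 := by
  have h : x ∈ (Submodule.span ℝ (Set.range a))ᗮ := by
    rw [Submodule.mem_orthogonal]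
    intro u hu
    induction hu using Submodule.span_induction with
    | mem u hu => obtain ⟨j, rfl⟩ := hu; exact hx j
    | zero => simp
    | add u v _ _ hu hv => rw [inner_add_left, hu, hv, add_zero]
    | smul c u _ hu => rw [inner_smul_left, hu, mul_zero]
  rwa [ha, Submodule.top_orthogonal_eq_bot, Submodule.mem_bot] at h

theorem frameOperator_injective {a : ι → E} (ha : Submodule.span ℝ (Set.range a) = ⊤)
    {w : ι → ℝ} (hw : ∀ j, 0 < w j) : Function.Injective (frameOperator a w) := by
  refine (injective_iff_map_eq_zero _).2 fun x hx => eq_zero_of_forall_inner_eq_zero ha fun j => ?_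
  have h := inner_frameOperator_self a w x
  rw [hx, inner_zero_right, eq_comm,
    Finset.sum_eq_zero_iff_of_nonneg fun j _ => mul_nonneg (hw j).le (sq_nonneg _)] at h
  simpa [(hw j).ne'] using h j (Finset.mem_univ j)

variable [FiniteDimensional ℝ E]

/-- A positive operator is of the form `x ↦ ‖B x‖²` as a quadratic form, where `(det B)² = det T`. -/
theorem exists_norm_sq_eq_inner {T : E →ₗ[ℝ] E} (hT : T.IsPositive) :
    ∃ B : E →ₗ[ℝ] E, (∀ x, ‖B x‖ ^ 2 = inner ℝ x (T x)) ∧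
      LinearMap.det B ^ 2 = LinearMap.det T := by
  let b := hT.isSymmetric.eigenvectorBasis rfl
  let l := hT.isSymmetric.eigenvalues rfl
  have hl : ∀ i, 0 ≤ l i := hT.nonneg_eigenvalues rfl
  have hTb : ∀ i, T (b i) = l i • b i := hT.isSymmetric.apply_eigenvectorBasis rfl
  -- The positive square root of `T`, diagonal in an eigenbasis.
  let B : E →ₗ[ℝ] E := b.toBasis.constr ℝ fun i => √(l i) • b i
  have hBb : ∀ i, B (b i) = √(l i) • b i := fun i => by
    rw [← b.coe_toBasis]
    exact (b.toBasis.constr_basis ℝ (fun i => √(l i) • b i) i).trans (by simp)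
  have hBB : B ∘ₗ B = T := b.toBasis.ext fun i => by
    simp [hBb, hTb, smul_smul, Real.mul_self_sqrt (hl i)]
  refine ⟨B, fun x => ?_, ?_⟩
  · have hsymm : ∀ i, inner ℝ (b i) (B x) = √(l i) * inner ℝ (b i) x := fun i => by
      conv_lhs => rw [← b.sum_repr' x]
      simp [map_sum, hBb, inner_sum, inner_smul_right, b.inner_eq_ite, mul_comm]
    have hsymm' : ∀ i, inner ℝ (b i) (T x) = l i * inner ℝ (b i) x := fun i => by
      rw [← hT.isSymmetric, hTb, inner_smul_left]; rfl
    rw [← real_inner_self_eq_norm_sq, ← b.sum_inner_mul_inner, ← b.sum_inner_mul_inner]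
    refine Finset.sum_congr rfl fun i _ => ?_
    rw [real_inner_comm, hsymm, hsymm', real_inner_comm (b i) x]
    linear_combination (inner ℝ (b i) x) ^ 2 * Real.mul_self_sqrt (hl i)
  · rw [sq, ← LinearMap.det_comp, hBB]

theorem det_frameOperator_pos {a : ι → E} (ha : Submodule.span ℝ (Set.range a) = ⊤)
    {w : ι → ℝ} (hw : ∀ j, 0 < w j) : 0 < (frameOperator a w).det := by
  obtain ⟨B, -, hB⟩ := exists_norm_sq_eq_inner (frameOperator_isPositive a fun j => (hw j).le)
  have h0 : 0 ≤ (frameOperator a w).det := (sq_nonneg (LinearMap.det B)).trans_eq hB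
  refine lt_of_le_of_ne h0 fun h => ?_
  exact (LinearMap.bot_lt_ker_of_det_eq_zero h.symm).ne'
    (LinearMap.ker_eq_bot.2 (frameOperator_injective ha hw))

/-- The minimal energy inequality: `v = ∑ t j y j a j = A z` satisfies `⟪z, A z⟫ ≤ ∑ t j (y j)²`. -/
theorem inner_frameOperator_le {ι E : Type*} [Fintype ι] [NormedAddCommGroup E]
    [InnerProductSpace ℝ E] (a : ι → E) {t : ι → ℝ} (ht : ∀ j, 0 ≤ t j) (y : ι → ℝ) {z : E}
    (hz : frameOperator a t z = ∑ j, (t j * y j) • a j) :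
    ∑ j, t j * inner ℝ (a j) z ^ 2 ≤ ∑ j, t j * y j ^ 2 := by
  have h1 : ∑ j, t j * inner ℝ (a j) z ^ 2 = ∑ j, t j * y j * inner ℝ (a j) z := by
    rw [← inner_frameOperator_self, hz]
    simp [inner_sum, inner_smul_right, real_inner_comm]
  -- By `h1` the cross term equals the quadratic term in `z`, so this sum of squares is exactly the
  -- difference of the two sides.
  have h2 : 0 ≤ ∑ j, t j * (y j - inner ℝ (a j) z) ^ 2 :=
    Finset.sum_nonneg fun j _ => mul_nonneg (ht j) (sq_nonneg _)
  have h3 : ∑ j, t j * (y j - inner ℝ (a j) z) ^ 2 = ∑ j, t j * y j ^ 2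
      - 2 * ∑ j, t j * y j * inner ℝ (a j) z + ∑ j, t j * inner ℝ (a j) z ^ 2 := by
    rw [Finset.mul_sum, ← Finset.sum_sub_distrib, ← Finset.sum_add_distrib]
    exact Finset.sum_congr rfl fun j _ => by ring
  linarith

end LinearAlgebra

/-! ### Gaussian integrals over `ℝ^M`. -/

section GaussianIntegral

variable {M N : ℕ}

/-- The integral of the standard (unnormalized) Gaussian function of `ℝ^M`. -/
def stdGaussianMass (M : ℕ) : ℝ≥0∞ :=
  ∫⁻ x : EuclideanSpace ℝ (Fin M), ENNReal.ofReal (Real.exp (-‖x‖ ^ 2 / 2))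

/-- The value of the mass is never needed: being nonzero and finite, it cancels from every
comparison. -/
theorem stdGaussianMass_ne_zero : stdGaussianMass M ≠ 0 := by
  refine ((lintegral_pos_iff_support (by fun_prop)).2 ?_).ne'
  have : Function.support (fun x : EuclideanSpace ℝ (Fin M) =>
      ENNReal.ofReal (Real.exp (-‖x‖ ^ 2 / 2))) = Set.univ := by
    ext x; simp [Real.exp_pos]
  rw [this]
  exact isOpen_univ.measure_pos _ Set.univ_nonempty

theorem stdGaussianMass_ne_top : stdGaussianMass M ≠ ∞ := by
  have h := GaussianFourier.integrable_cexp_neg_mul_sq_norm_add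
    (V := EuclideanSpace ℝ (Fin M)) (b := (1 / 2 : ℂ)) (by norm_num) 0 0
  refine ne_of_eq_of_ne (lintegral_congr fun x => ?_) h.norm.lintegral_lt_top.ne
  congr 1
  rw [Complex.norm_exp]
  congr 1
  simp [← Complex.ofReal_pow]
  norm_num [← Complex.ofReal_pow]
  ring

/-- Substitute `x ↦ B x`, where `‖B x‖² = ⟪x, T x⟫` and `|det B| = √(det T)`. -/
theorem lintegral_exp_neg_inner {T : EuclideanSpace ℝ (Fin M) →ₗ[ℝ] EuclideanSpace ℝ (Fin M)}
    (hT : T.IsPositive) (hdet : LinearMap.det T ≠ 0) :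
    ∫⁻ x, ENNReal.ofReal (Real.exp (-inner ℝ x (T x) / 2)) =
      ENNReal.ofReal (√(LinearMap.det T))⁻¹ * stdGaussianMass M := by
  obtain ⟨B, hB, hB'⟩ := exists_norm_sq_eq_inner hT
  have hB0 : LinearMap.det B ≠ 0 := by rintro h; simp [h, hdet.symm] at hB'
  have h := Measure.map_linearMap_addHaar_eq_smul_addHaar volume hB0
  have hmeas : Measurable B := B.continuous_of_finiteDimensional.measurable
  rw [← hB', Real.sqrt_sq_eq_abs, ← abs_inv, stdGaussianMass, ← smul_eq_mul,
    ← lintegral_smul_measure, ← h, lintegral_map (by fun_prop) hmeas]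
  simp [hB]

end GaussianIntegral

/-! ### Monotone transport on the line. -/

section Transport

open Filter Topology

/-- The primitive `y ↦ ∫ x in (-∞, y], h x`. -/
def cumulative (h : ℝ → ℝ) (y : ℝ) : ℝ := ∫ x in Set.Iic y, h x

variable {h g : ℝ → ℝ}

theorem cumulative_sub (hi : Integrable h) (y z : ℝ) :
    cumulative h z - cumulative h y = ∫ x in y..z, h x :=
  intervalIntegral.integral_Iic_sub_Iic hi.integrableOn hi.integrableOn

theorem hasStrictDerivAt_cumulative (hc : Continuous h) (hi : Integrable h) (y : ℝ) :
    HasStrictDerivAt (cumulative h) (h y) y := by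
  have h1 : cumulative h = fun z => cumulative h 0 + ∫ x in (0 : ℝ)..z, h x := by
    ext z; rw [← cumulative_sub hi, add_sub_cancel]
  rw [h1]
  exact (intervalIntegral.integral_hasStrictDerivAt_right hi.intervalIntegrable
    hc.aestronglyMeasurable.stronglyMeasurableAtFilter hc.continuousAt).const_add _

theorem tendsto_cumulative_atTop (hi : Integrable h) :
    Tendsto (cumulative h) atTop (𝓝 (∫ x, h x)) :=
  (aecover_Iic tendsto_id).integral_tendsto_of_countably_generated hi

theorem tendsto_cumulative_atBot (hi : Integrable h) :
    Tendsto (cumulative h) atBot (𝓝 0) := by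
  have h1 := intervalIntegral_tendsto_integral_Iic 0 hi.integrableOn (f := h) tendsto_id
  have h2 : cumulative h = fun y => cumulative h 0 - ∫ x in y..0, h x := by
    ext z; rw [← cumulative_sub hi, sub_sub_cancel]
  rw [h2]
  simpa [cumulative] using h1.const_sub (cumulative h 0)

theorem strictMono_cumulative (hc : Continuous h) (hi : Integrable h) (hpos : ∀ y, 0 < h y) :
    StrictMono (cumulative h) :=
  strictMono_of_hasDerivAt_pos (fun y => (hasStrictDerivAt_cumulative hc hi y).hasDerivAt) hpos

theorem cumulative_pos (hc : Continuous h) (hi : Integrable h) (hpos : ∀ y, 0 < h y) (y : ℝ) :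
    0 < cumulative h y :=
  ((strictMono_cumulative hc hi hpos).monotone.le_of_tendsto
    (tendsto_cumulative_atBot hi) (y - 1)).trans_lt
      (strictMono_cumulative hc hi hpos (sub_one_lt y))

theorem cumulative_lt (hc : Continuous h) (hi : Integrable h) (hpos : ∀ y, 0 < h y) (y : ℝ) :
    cumulative h y < ∫ x, h x :=
  (strictMono_cumulative hc hi hpos (lt_add_one y)).trans_le
    ((strictMono_cumulative hc hi hpos).monotone.ge_of_tendsto (tendsto_cumulative_atTop hi) _)

theorem exists_cumulative_eq (hc : Continuous h) (hi : Integrable h) {v : ℝ} (hv : 0 < v)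
    (hv' : v < ∫ x, h x) : ∃ y, cumulative h y = v := by
  have hcont : Continuous (cumulative h) := continuous_iff_continuousAt.2 fun y =>
    (hasStrictDerivAt_cumulative hc hi y).hasDerivAt.continuousAt
  obtain ⟨y, hy⟩ := ((tendsto_cumulative_atBot hi).eventually (gt_mem_nhds hv)).exists
  obtain ⟨z, hz⟩ := ((tendsto_cumulative_atTop hi).eventually (lt_mem_nhds hv')).exists
  exact mem_range_of_exists_le_of_exists_ge hcont ⟨y, hy.le⟩ ⟨z, hz.le⟩

/-- The monotone transport of the density `h / ∫ h` onto the density `g / ∫ g`. -/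
theorem exists_transport (hc : Continuous h) (hi : Integrable h) (hpos : ∀ y, 0 < h y)
    (gc : Continuous g) (gi : Integrable g) (gpos : ∀ y, 0 < g y) :
    ∃ T T' : ℝ → ℝ, ∀ y, HasDerivAt T (T' y) y ∧ 0 < T' y ∧
      T' y * g (T y) * ∫ x, h x = h y * ∫ x, g x := by
  have hI : 0 < ∫ x, h x := (cumulative_pos hc hi hpos 0).trans (cumulative_lt hc hi hpos 0)
  have gI : 0 < ∫ x, g x := (cumulative_pos gc gi gpos 0).trans (cumulative_lt gc gi gpos 0)
  set κ : ℝ := (∫ x, g x) / ∫ x, h x with hκ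
  have κpos : 0 < κ := div_pos gI hI
  have hex : ∀ y, ∃ z, cumulative g z = κ * cumulative h y := fun y => by
    refine exists_cumulative_eq gc gi (mul_pos κpos (cumulative_pos hc hi hpos y)) ?_
    calc κ * cumulative h y < κ * ∫ x, h x :=
          mul_lt_mul_of_pos_left (cumulative_lt hc hi hpos y) κpos
      _ = ∫ x, g x := div_mul_cancel₀ _ hI.ne'
  choose T hT using hex
  -- Monotone and surjective imply continuous. Continuity keeps `T z` near `T y`, where the local
  -- inverse of `cumulative g` recovers `T`, so that `T` can be differentiated.
  have Tmono : Monotone T := fun y z hyz => by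
    rw [← (strictMono_cumulative gc gi gpos).le_iff_le, hT, hT]
    exact mul_le_mul_of_nonneg_left ((strictMono_cumulative hc hi hpos).monotone hyz) κpos.le
  have Tsurj : Function.Surjective T := fun z => by
    obtain ⟨y, hy⟩ := exists_cumulative_eq hc hi (v := κ⁻¹ * cumulative g z)
      (mul_pos (inv_pos.2 κpos) (cumulative_pos gc gi gpos z)) (by
        calc κ⁻¹ * cumulative g z < κ⁻¹ * ∫ x, g x :=
              mul_lt_mul_of_pos_left (cumulative_lt gc gi gpos z) (inv_pos.2 κpos)
          _ = ∫ x, h x := by rw [hκ]; field_simp)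
    refine ⟨y, (strictMono_cumulative gc gi gpos).injective ?_⟩
    rw [hT, hy, mul_inv_cancel_left₀ κpos.ne']
  have Tcont : Continuous T := Tmono.continuous_of_surjective Tsurj
  refine ⟨T, fun y => (g (T y))⁻¹ * (κ * h y), fun y => ⟨?_, ?_, ?_⟩⟩
  · have hs := hasStrictDerivAt_cumulative gc gi (T y)
    have h1 := (hs.to_localInverse (gpos _).ne').hasDerivAt
    rw [hT] at h1
    have h2 := h1.comp y ((hasStrictDerivAt_cumulative hc hi y).hasDerivAt.const_mul κ)
    refine h2.congr_of_eventuallyEq ?_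
    filter_upwards [Tcont.continuousAt.eventually (hs.eventually_left_inverse (gpos _).ne')]
      with z hz
    rw [Function.comp_apply, ← hT z, hz]
  · exact mul_pos (inv_pos.2 (gpos _)) (mul_pos κpos (hpos y))
  · have := (gpos (T y)).ne'
    rw [hκ]
    field_simp

theorem integrable_rpow_of_memLp {p : ℝ≥0∞} (hp0 : p ≠ 0) (hp : p ≠ ∞) (hpos : ∀ y, 0 < h y)
    (hm : MemLp h p) : Integrable fun y => h y ^ p.toReal := by
  simpa only [Real.norm_eq_abs, abs_of_pos (hpos _)] using hm.integrable_norm_rpow hp0 hp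

theorem toReal_eLpNorm_of_pos {p : ℝ≥0∞} (hp0 : p ≠ 0) (hp : p ≠ ∞) (hpos : ∀ y, 0 < h y)
    (hm : MemLp h p) :
    (eLpNorm h p).toReal = (∫ y, h y ^ p.toReal) ^ p.toReal⁻¹ := by
  rw [hm.eLpNorm_eq_integral_rpow_norm hp0 hp, ENNReal.toReal_ofReal (by positivity)]
  simp only [Real.norm_eq_abs, abs_of_pos (hpos _)]

/-- Transport the `p`-th powers, which are integrable, and take `p`-th roots of the resulting
Jacobian equation. The norms are cross-multiplied to avoid division. -/
theorem exists_transport_of_memLp {p : ℝ≥0∞} (hp0 : p ≠ 0) (hp : p ≠ ∞)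
    (hc : Continuous h) (hm : MemLp h p) (hpos : ∀ y, 0 < h y)
    (gc : Continuous g) (gm : MemLp g p) (gpos : ∀ y, 0 < g y) :
    ∃ T T' : ℝ → ℝ, ∀ y, HasDerivAt T (T' y) y ∧ 0 < T' y ∧
      h y * (eLpNorm g p).toReal = T' y ^ p.toReal⁻¹ * g (T y) * (eLpNorm h p).toReal := by
  have hp' : 0 < p.toReal := ENNReal.toReal_pos hp0 hp
  obtain ⟨T, T', hT⟩ := exists_transport (hc.rpow_const fun y => Or.inl (hpos y).ne')
    (integrable_rpow_of_memLp hp0 hp hpos hm) (fun y => Real.rpow_pos_of_pos (hpos y) _)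
    (gc.rpow_const fun y => Or.inl (gpos y).ne')
    (integrable_rpow_of_memLp hp0 hp gpos gm) (fun y => Real.rpow_pos_of_pos (gpos y) _)
  refine ⟨T, T', fun y => ⟨(hT y).1, (hT y).2.1, ?_⟩⟩
  have hI : 0 ≤ ∫ y, h y ^ p.toReal := integral_nonneg fun y => Real.rpow_nonneg (hpos y).le _
  have gI : 0 ≤ ∫ y, g y ^ p.toReal := integral_nonneg fun y => Real.rpow_nonneg (gpos y).le _
  have key := congrArg (· ^ p.toReal⁻¹) (hT y).2.2
  rw [Real.mul_rpow (mul_nonneg (hT y).2.1.le (Real.rpow_nonneg (gpos _).le _)) hI,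
    Real.mul_rpow (hT y).2.1.le (Real.rpow_nonneg (gpos _).le _),
    Real.mul_rpow (Real.rpow_nonneg (hpos _).le _) gI,
    Real.rpow_rpow_inv (gpos _).le hp'.ne', Real.rpow_rpow_inv (hpos _).le hp'.ne'] at key
  rw [toReal_eLpNorm_of_pos hp0 hp hpos hm, toReal_eLpNorm_of_pos hp0 hp gpos gm, key]

end Transport

/-! ### Gaussian test functions and the determinant form of maximality. -/

section Gaussian

theorem continuous_gaussian (c s : ℝ) : Continuous (gaussian c s) := by
  unfold gaussian; fun_prop

theorem gaussian_pos {c : ℝ} (hc : 0 < c) (s y : ℝ) : 0 < gaussian c s y :=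
  mul_pos hc (Real.exp_pos _)

theorem memLp_gaussian (c : ℝ) {s : ℝ} (hs : 0 < s) (p : ℝ≥0∞) : MemLp (gaussian c s) p := by
  refine MemLp.const_mul (f := fun y => Real.exp (-(s * y) ^ 2 / 2)) ?_ c
  have hmeas : AEStronglyMeasurable (fun y : ℝ => Real.exp (-(s * y) ^ 2 / 2)) :=
    Continuous.aestronglyMeasurable (by fun_prop)
  rcases eq_or_ne p 0 with rfl | hp0
  · exact memLp_zero_iff_aestronglyMeasurable.2 hmeas
  rcases eq_or_ne p ∞ with rfl | hp
  · refine memLp_top_of_bound hmeas 1 (.of_forall fun y => ?_)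
    rw [Real.norm_eq_abs, Real.abs_exp, Real.exp_le_one_iff]
    nlinarith [sq_nonneg (s * y)]
  · have hp' : 0 < p.toReal := ENNReal.toReal_pos hp0 hp
    refine (integrable_norm_rpow_iff hmeas hp0 hp).1 ?_
    refine (integrable_exp_neg_mul_sq (b := p.toReal * s ^ 2 / 2) (by positivity)).congr
      (.of_forall fun y => ?_)
    simp only [Real.norm_eq_abs, Real.abs_exp, ← Real.exp_mul]
    ring_nf

theorem eLpNorm_ne_zero_of_pos {h : ℝ → ℝ} (hc : Continuous h) (hpos : ∀ y, 0 < h y)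
    {p : ℝ≥0∞} (hp : p ≠ 0) : eLpNorm h p ≠ 0 := by
  rw [Ne, eLpNorm_eq_zero_iff hc.aestronglyMeasurable hp]
  intro h0
  obtain ⟨y, hy⟩ := h0.exists
  exact (hpos y).ne' hy

theorem eLpNorm_gaussian_ne_zero {c : ℝ} (hc : 0 < c) (s : ℝ) {p : ℝ≥0∞} (hp : p ≠ 0) :
    eLpNorm (gaussian c s) p ≠ 0 :=
  eLpNorm_ne_zero_of_pos (continuous_gaussian c s) (gaussian_pos hc s) hp

/-- Dilation scaling. For `p = ∞` the exponent `p.toReal⁻¹` is `0`, so the factor is correctly `1`.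
-/
theorem eLpNorm_gaussian_one {s : ℝ} (hs : 0 < s) (p : ℝ≥0∞) :
    eLpNorm (gaussian 1 s) p =
      ENNReal.ofReal ((s ^ p.toReal⁻¹)⁻¹) * eLpNorm (gaussian 1 1) p := by
  have h1 : gaussian 1 s = gaussian 1 1 ∘ fun y => s * y := by ext y; simp [gaussian]
  have hc : ENNReal.ofReal |s⁻¹| ≠ 0 := by simpa using hs.ne'
  rw [h1, ← eLpNorm_map_measure (continuous_gaussian 1 1).aestronglyMeasurable
    (measurable_const_mul s).aemeasurable, Real.map_volume_mul_left hs.ne',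
    eLpNorm_smul_measure_of_ne_zero hc, smul_eq_mul, abs_of_pos (inv_pos.2 hs),
    ENNReal.ofReal_rpow_of_pos (inv_pos.2 hs), Real.inv_rpow hs.le]
  simp

variable {M N : ℕ}

theorem prod_gaussian_one (s y : Fin N → ℝ) :
    ∏ j, gaussian 1 (s j) (y j) = Real.exp (-(∑ j, s j ^ 2 * y j ^ 2) / 2) := by
  simp only [gaussian, one_mul, ← Real.exp_sum]
  rw [← Finset.sum_div, Finset.sum_neg_distrib]
  simp only [mul_pow]

theorem productIntegral_gaussian_one {a : Fin N → EuclideanSpace ℝ (Fin M)}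
    (ha : Submodule.span ℝ (Set.range a) = ⊤) {s : Fin N → ℝ} (hs : ∀ j, 0 < s j) :
    productIntegral a (fun j => gaussian 1 (s j)) =
      ENNReal.ofReal (√(frameOperator a fun j => s j ^ 2).det)⁻¹ * stdGaussianMass M := by
  rw [ContinuousLinearMap.det, ← lintegral_exp_neg_inner
    (frameOperator_isPositive a fun j => sq_nonneg (s j))
    (det_frameOperator_pos ha fun j => pow_pos (hs j) 2).ne', productIntegral]
  simp only [prod_gaussian_one, ContinuousLinearMap.coe_coe, inner_frameOperator_self]

theorem productNorm_gaussian_one {s : Fin N → ℝ} (hs : ∀ j, 0 < s j) (p : Fin N → ℝ≥0∞) :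
    productNorm p (fun j => gaussian 1 (s j)) =
      ENNReal.ofReal (∏ j, s j ^ (p j).toReal⁻¹)⁻¹ * productNorm p fun _ => gaussian 1 1 := by
  simp only [productNorm, eLpNorm_gaussian_one (hs _)]
  rw [Finset.prod_mul_distrib, ← Finset.prod_inv_distrib, ENNReal.ofReal_prod_of_nonneg]
  exact fun j _ => inv_nonneg.2 (Real.rpow_nonneg (hs j).le _)

theorem productNorm_ne_top {p : Fin N → ℝ≥0∞} {f : Fin N → ℝ → ℝ} (hf : ∀ j, MemLp (f j) (p j)) :
    productNorm p f ≠ ∞ :=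
  ENNReal.prod_ne_top fun j _ => (hf j).eLpNorm_ne_top

theorem productNorm_ne_zero {p : Fin N → ℝ≥0∞} {f : Fin N → ℝ → ℝ}
    (hf : ∀ j, eLpNorm (f j) (p j) ≠ 0) : productNorm p f ≠ 0 :=
  Finset.prod_ne_zero_iff.2 fun j _ => hf j

theorem productIntegral_le_gaussianConstant_mul (a : Fin N → EuclideanSpace ℝ (Fin M))
    {p : Fin N → ℝ≥0∞} (hp : ∀ j, p j ≠ 0) {g : Fin N → ℝ → ℝ}
    (hg : ∀ j, IsCenteredGaussian (g j)) :
    productIntegral a g ≤ gaussianConstant a p * productNorm p g := by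
  have h0 : productNorm p g ≠ 0 := productNorm_ne_zero fun j => by
    obtain ⟨c, s, hc, -, h⟩ := hg j
    rw [h]; exact eLpNorm_gaussian_ne_zero hc s (hp j)
  have h1 : productNorm p g ≠ ∞ := productNorm_ne_top fun j => by
    obtain ⟨c, s, -, hs, h⟩ := hg j
    rw [h]; exact memLp_gaussian c hs _
  exact (ENNReal.div_le_iff_le_mul (.inl h0) (.inl h1)).1 (le_sSup ⟨g, hg, rfl⟩)

theorem gaussianConstant_le_bestConstant (a : Fin N → EuclideanSpace ℝ (Fin M))
    {p : Fin N → ℝ≥0∞} (hp : ∀ j, p j ≠ 0) : gaussianConstant a p ≤ bestConstant a p := by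
  refine sSup_le_sSup ?_
  rintro r ⟨g, hg, rfl⟩
  refine ⟨g, fun j => ?_, rfl⟩
  obtain ⟨c, s, hc, hs, h⟩ := hg j
  rw [h]
  exact ⟨fun y => (gaussian_pos hc s y).le, memLp_gaussian c hs _,
    eLpNorm_gaussian_ne_zero hc s (hp j)⟩

section Maximizer

variable {a : Fin N → EuclideanSpace ℝ (Fin M)} {p : Fin N → ℝ≥0∞} {s : Fin N → ℝ}

theorem productIntegral_mul_productNorm_le_of_maximizer (hp : ∀ j, p j ≠ 0)
    (hmax : productIntegral a (fun j => gaussian 1 (s j)) =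
      gaussianConstant a p * productNorm p (fun j => gaussian 1 (s j)))
    {u : Fin N → ℝ} (hu : ∀ j, 0 < u j) :
    productIntegral a (fun j => gaussian 1 (u j)) * productNorm p (fun j => gaussian 1 (s j)) ≤
      productIntegral a (fun j => gaussian 1 (s j)) *
        productNorm p (fun j => gaussian 1 (u j)) := by
  rw [hmax, mul_right_comm]
  exact mul_le_mul_left (productIntegral_le_gaussianConstant_mul a hp
    fun j => ⟨1, u j, one_pos, hu j, rfl⟩) _

/-- Maximality of `s` in the Gaussian problem, expressed through determinants. -/
theorem det_frameOperator_mul_prod_le (ha : Submodule.span ℝ (Set.range a) = ⊤)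
    (hp : ∀ j, p j ≠ 0) (hs : ∀ j, 0 < s j)
    (hmax : productIntegral a (fun j => gaussian 1 (s j)) =
      gaussianConstant a p * productNorm p (fun j => gaussian 1 (s j)))
    {r : Fin N → ℝ} (hr : ∀ j, 0 < r j) :
    (frameOperator a fun j => s j ^ 2).det * ∏ j, r j ^ (p j).toReal⁻¹ ≤
      (frameOperator a fun j => s j ^ 2 * r j).det := by
  -- These competitors have squared parameters `s j ^ 2 * r j`, the weights in the claim.
  have hu : ∀ j, 0 < s j * √(r j) := fun j => mul_pos (hs j) (Real.sqrt_pos.2 (hr j))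
  have hu2 : (fun j => (s j * √(r j)) ^ 2) = fun j => s j ^ 2 * r j := by
    ext j; rw [mul_pow, Real.sq_sqrt (hr j).le]
  have key := productIntegral_mul_productNorm_le_of_maximizer hp hmax hu
  have h0 : productNorm p (fun _ => gaussian 1 1) ≠ 0 :=
    productNorm_ne_zero fun j => eLpNorm_gaussian_ne_zero one_pos 1 (hp j)
  have h1 : productNorm p (fun _ => gaussian 1 1) ≠ ∞ :=
    productNorm_ne_top fun j => memLp_gaussian 1 one_pos _
  rw [productIntegral_gaussian_one ha hu, productIntegral_gaussian_one ha hs,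
    productNorm_gaussian_one hs, productNorm_gaussian_one hu, hu2,
    mul_mul_mul_comm, mul_mul_mul_comm (ENNReal.ofReal _) (stdGaussianMass M),
    ENNReal.mul_le_mul_iff_left (mul_ne_zero stdGaussianMass_ne_zero h0)
      (ENNReal.mul_ne_top stdGaussianMass_ne_top h1)] at key
  have hA := det_frameOperator_pos ha fun j => pow_pos (hs j) 2
  have hB := det_frameOperator_pos ha fun j => mul_pos (pow_pos (hs j) 2) (hr j)
  set A := (frameOperator a fun j => s j ^ 2).det
  set B := (frameOperator a fun j => s j ^ 2 * r j).det
  have hP : 0 < ∏ j, s j ^ (p j).toReal⁻¹ :=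
    Finset.prod_pos fun j _ => Real.rpow_pos_of_pos (hs j) _
  have hR : 0 < ∏ j, √(r j) ^ (p j).toReal⁻¹ :=
    Finset.prod_pos fun j _ => Real.rpow_pos_of_pos (Real.sqrt_pos.2 (hr j)) _
  have hPR : ∏ j, (s j * √(r j)) ^ (p j).toReal⁻¹ =
      (∏ j, s j ^ (p j).toReal⁻¹) * ∏ j, √(r j) ^ (p j).toReal⁻¹ := by
    rw [← Finset.prod_mul_distrib]
    exact Finset.prod_congr rfl fun j _ => Real.mul_rpow (hs j).le (Real.sqrt_nonneg _)
  have hR2 : ∏ j, r j ^ (p j).toReal⁻¹ = (∏ j, √(r j) ^ (p j).toReal⁻¹) ^ 2 := by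
    rw [← Finset.prod_pow]
    refine Finset.prod_congr rfl fun j _ => ?_
    rw [sq, ← Real.mul_rpow (Real.sqrt_nonneg _) (Real.sqrt_nonneg _),
      Real.mul_self_sqrt (hr j).le]
  rw [hPR] at key
  set P := ∏ j, s j ^ (p j).toReal⁻¹
  set R := ∏ j, √(r j) ^ (p j).toReal⁻¹
  rw [← ENNReal.ofReal_mul (by positivity), ← ENNReal.ofReal_mul (by positivity),
    ENNReal.ofReal_le_ofReal_iff (by positivity)] at key
  have hA' := Real.sqrt_pos.2 hA
  have hB' := Real.sqrt_pos.2 hB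
  have h2 : √A * R ≤ √B := by
    rw [← mul_inv, ← mul_inv, inv_le_inv₀ (by positivity) (by positivity)] at key
    refine le_of_mul_le_mul_right ?_ hP
    linarith
  rw [hR2, ← Real.sq_sqrt hA.le, ← Real.sq_sqrt hB.le, ← mul_pow]
  exact pow_le_pow_left₀ (by positivity) h2 2

end Maximizer

end Gaussian

open Filter Topology

variable {M N : ℕ} {a : Fin N → EuclideanSpace ℝ (Fin M)} {p : Fin N → ℝ≥0∞} {s : Fin N → ℝ}

/-- A nonzero functional pushes Lebesgue measure to a multiple of Lebesgue measure, so preimages of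
null sets are null. -/
theorem ae_inner_of_ae {v : EuclideanSpace ℝ (Fin M)} (hv : v ≠ 0) {P : ℝ → Prop}
    (h : ∀ᵐ y, P y) : ∀ᵐ x : EuclideanSpace ℝ (Fin M), P (inner ℝ v x) := by
  have hsurj : Function.Surjective (innerₗ (EuclideanSpace ℝ (Fin M)) v) :=
    LinearMap.surjective fun h0 => hv (by simpa using LinearMap.congr_fun h0 v)
  obtain ⟨c, -, hc⟩ := LinearMap.exists_map_addHaar_eq_smul_addHaar _ volume (volume : Measure ℝ)
    hsurj
  refine ae_of_ae_map
    (LinearMap.continuous_of_finiteDimensional (innerₗ (EuclideanSpace ℝ (Fin M)) v)).aemeasurable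
    (p := P) ?_
  rw [hc]
  exact Measure.ae_smul_measure h c

/-- If `p j = ∞`, halving `s j` leaves all norms unchanged but strictly increases the integrand
wherever `a j · x ≠ 0`, hence almost everywhere. This contradicts maximality. -/
theorem exponent_ne_top_of_maximizer (ha : ∀ j, a j ≠ 0)
    (hspan : Submodule.span ℝ (Set.range a) = ⊤) (hp : ∀ j, p j ≠ 0) (hs : ∀ j, 0 < s j)
    (hmax : productIntegral a (fun j => gaussian 1 (s j)) =
      gaussianConstant a p * productNorm p (fun j => gaussian 1 (s j))) (j : Fin N) :
    p j ≠ ∞ := by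
  intro hj
  set u : Fin N → ℝ := Function.update s j (s j / 2) with hu_def
  have huj : u j = s j / 2 := by simp [u]
  have hui : ∀ i, i ≠ j → u i = s i := fun i hi => by simp [u, hi]
  have hu : ∀ i, 0 < u i := fun i => by
    rcases eq_or_ne i j with rfl | hi
    · rw [huj]; exact half_pos (hs i)
    · rw [hui i hi]; exact hs i
  have hle := productIntegral_mul_productNorm_le_of_maximizer hp hmax hu
  have hnorm : productNorm p (fun i => gaussian 1 (u i)) =
      productNorm p (fun i => gaussian 1 (s i)) := by
    rw [productNorm_gaussian_one hs, productNorm_gaussian_one hu]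
    congr 3
    refine Finset.prod_congr rfl fun i _ => ?_
    rcases eq_or_ne i j with rfl | hi
    · simp [hj]
    · rw [hui i hi]
  have h0 : productNorm p (fun i => gaussian 1 (s i)) ≠ 0 :=
    productNorm_ne_zero fun i => eLpNorm_gaussian_ne_zero one_pos _ (hp i)
  have h1 : productNorm p (fun i => gaussian 1 (s i)) ≠ ∞ :=
    productNorm_ne_top fun i => memLp_gaussian 1 (hs i) _
  rw [hnorm, ENNReal.mul_le_mul_iff_left h0 h1] at hle
  refine hle.not_gt (lintegral_strict_mono (NeZero.ne _) ?_ ?_ ?_)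
  · simp only [prod_gaussian_one]
    fun_prop
  · exact ne_of_eq_of_ne (productIntegral_gaussian_one hspan hs)
      (ENNReal.mul_ne_top ENNReal.ofReal_ne_top stdGaussianMass_ne_top)
  · filter_upwards [ae_inner_of_ae (ha j) (volume.ae_ne (0 : ℝ))] with x hx
    simp only [prod_gaussian_one]
    rw [ENNReal.ofReal_lt_ofReal_iff (Real.exp_pos _), Real.exp_lt_exp]
    have : ∑ i, u i ^ 2 * inner ℝ (a i) x ^ 2 < ∑ i, s i ^ 2 * inner ℝ (a i) x ^ 2 := by
      refine Finset.sum_lt_sum (fun i _ => ?_) ⟨j, Finset.mem_univ j, ?_⟩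
      · rcases eq_or_ne i j with rfl | hi
        · rw [huj]
          nlinarith [mul_nonneg (sq_nonneg (s i)) (sq_nonneg (inner ℝ (a i) x))]
        · rw [hui i hi]
      · rw [huj]
        have := mul_pos (pow_pos (hs j) 2) (pow_pos (abs_pos.2 hx) 2)
        rw [sq_abs] at this
        linarith
    linarith

/-! ### The transport map on `ℝ^M`. -/

section MassTransport

variable {ι E : Type*} [Fintype ι] [NormedAddCommGroup E] [InnerProductSpace ℝ E]

theorem hasFDerivAt_sum_comp_inner (a : ι → E) (t : ι → ℝ) {T T' : ι → ℝ → ℝ}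
    (hT : ∀ j y, HasDerivAt (T j) (T' j y) y) (x : E) :
    HasFDerivAt (fun x => ∑ j, (t j * T j (inner ℝ (a j) x)) • a j)
      (frameOperator a fun j => t j * T' j (inner ℝ (a j) x)) x := by
  refine (HasFDerivAt.fun_sum fun j _ => (((hT j (inner ℝ (a j) x)).comp_hasFDerivAt x
    (innerSL ℝ (a j)).hasFDerivAt).const_mul (t j)).smul_const (a j)).congr_fderiv ?_
  ext y
  simp [frameOperator_apply, mul_assoc]

/-- Pair the difference of the two values with `x - y`: monotonicity makes every term nonnegative,
so all vanish, and the `a j` span. -/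
theorem injective_sum_comp_inner {a : ι → E} (ha : Submodule.span ℝ (Set.range a) = ⊤)
    {t : ι → ℝ} (ht : ∀ j, 0 < t j) {T : ι → ℝ → ℝ} (hT : ∀ j, StrictMono (T j)) :
    Function.Injective fun x => ∑ j, (t j * T j (inner ℝ (a j) x)) • a j := by
  intro x y hxy
  have hnn : ∀ j, 0 ≤ t j * ((T j (inner ℝ (a j) x) - T j (inner ℝ (a j) y)) *
      (inner ℝ (a j) x - inner ℝ (a j) y)) := fun j => by
    refine mul_nonneg (ht j).le ?_
    rcases le_total (inner ℝ (a j) x) (inner ℝ (a j) y) with h | h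
    · exact mul_nonneg_of_nonpos_of_nonpos (sub_nonpos.2 ((hT j).monotone h)) (sub_nonpos.2 h)
    · exact mul_nonneg (sub_nonneg.2 ((hT j).monotone h)) (sub_nonneg.2 h)
  have h0 : ∑ j, t j * ((T j (inner ℝ (a j) x) - T j (inner ℝ (a j) y)) *
      (inner ℝ (a j) x - inner ℝ (a j) y)) = 0 := by
    have := congrArg (inner ℝ (x - y)) (sub_eq_zero.2 hxy)
    rw [inner_zero_right, ← Finset.sum_sub_distrib, inner_sum] at this
    rw [← this]
    refine Finset.sum_congr rfl fun j _ => ?_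
    rw [← sub_smul, inner_smul_right, real_inner_comm (a j) (x - y), inner_sub_right]
    ring
  rw [Finset.sum_eq_zero_iff_of_nonneg fun j _ => hnn j] at h0
  refine sub_eq_zero.1 (eq_zero_of_forall_inner_eq_zero ha fun j => ?_)
  rw [inner_sub_right, sub_eq_zero]
  rcases mul_eq_zero.1 ((mul_eq_zero.1 (h0 j (Finset.mem_univ j))).resolve_left (ht j).ne')
    with h | h
  · exact (hT j).injective (sub_eq_zero.1 h)
  · exact sub_eq_zero.1 h

end MassTransport

/-- The change of variables behind the mass transport argument. -/
theorem lintegral_det_mul_comp_le {E : Type*} [NormedAddCommGroup E] [NormedSpace ℝ E]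
    [FiniteDimensional ℝ E] [MeasurableSpace E] [BorelSpace E] (μ : Measure E)
    [μ.IsAddHaarMeasure] {Θ : E → E} {Θ' : E → E →L[ℝ] E} (hΘ : ∀ x, HasFDerivAt Θ (Θ' x) x)
    (hinj : Function.Injective Θ) (G : E → ℝ≥0∞) :
    ∫⁻ x, ENNReal.ofReal |(Θ' x).det| * G (Θ x) ∂μ ≤ ∫⁻ x, G x ∂μ := by
  have := lintegral_image_eq_lintegral_abs_det_fderiv_mul μ MeasurableSet.univ
    (fun x _ => (hΘ x).hasFDerivWithinAt) hinj.injOn G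
  rw [Measure.restrict_univ] at this
  rw [← this]
  -- The integral over the range of `Θ` is at most the full one, so surjectivity is not required.
  exact setLIntegral_le_lintegral _ _

theorem ofReal_prod_toReal_eLpNorm {f : Fin N → ℝ → ℝ} (hf : ∀ j, MemLp (f j) (p j)) :
    ENNReal.ofReal (∏ j, (eLpNorm (f j) (p j)).toReal) = productNorm p f := by
  rw [ENNReal.ofReal_prod_of_nonneg fun j _ => ENNReal.toReal_nonneg]
  exact Finset.prod_congr rfl fun j _ => ENNReal.ofReal_toReal (hf j).eLpNorm_ne_top

/-- The transport argument proper: a pointwise bound on the integrand, then the change of variables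
`A⁻¹ ∘ Ψ`. -/
theorem productIntegral_le_of_continuous_of_pos
    (hspan : Submodule.span ℝ (Set.range a) = ⊤) (hp : ∀ j, p j ≠ 0) (hp' : ∀ j, p j ≠ ∞)
    (hs : ∀ j, 0 < s j)
    (hmax : productIntegral a (fun j => gaussian 1 (s j)) =
      gaussianConstant a p * productNorm p (fun j => gaussian 1 (s j)))
    {h : Fin N → ℝ → ℝ} (hc : ∀ j, Continuous (h j)) (hm : ∀ j, MemLp (h j) (p j))
    (hpos : ∀ j y, 0 < h j y) :
    productIntegral a h ≤ gaussianConstant a p * productNorm p h := by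
  have gm : ∀ j, MemLp (gaussian 1 (s j)) (p j) := fun j => memLp_gaussian 1 (hs j) _
  have g0 : productNorm p (fun j => gaussian 1 (s j)) ≠ 0 :=
    productNorm_ne_zero fun j => eLpNorm_gaussian_ne_zero one_pos _ (hp j)
  suffices H : productIntegral a h * productNorm p (fun j => gaussian 1 (s j)) ≤
      productNorm p h * productIntegral a (fun j => gaussian 1 (s j)) by
    rw [hmax, ← mul_assoc, ENNReal.mul_le_mul_iff_left g0 (productNorm_ne_top gm)] at H
    rwa [mul_comm]
  choose T T' hT using fun j => exists_transport_of_memLp (hp j) (hp' j) (hc j) (hm j) (hpos j)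
    (continuous_gaussian 1 (s j)) (gm j) (gaussian_pos one_pos (s j))
  have ht : ∀ j, 0 < s j ^ 2 := fun j => pow_pos (hs j) 2
  let A := (LinearEquiv.ofInjectiveEndo
    (frameOperator a fun j => s j ^ 2 : _ →ₗ[ℝ] EuclideanSpace ℝ (Fin M))
    (frameOperator_injective hspan ht)).toContinuousLinearEquiv
  have hA : ∀ x, A x = frameOperator a (fun j => s j ^ 2) x := fun x => rfl
  have hdetA : (A.symm : EuclideanSpace ℝ (Fin M) →L[ℝ] EuclideanSpace ℝ (Fin M)).det =
      (frameOperator a fun j => s j ^ 2).det⁻¹ := LinearEquiv.det_coe_symm _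
  let Ψ : EuclideanSpace ℝ (Fin M) → EuclideanSpace ℝ (Fin M) :=
    fun x => ∑ j, (s j ^ 2 * T j (inner ℝ (a j) x)) • a j
  have hΨ := hasFDerivAt_sum_comp_inner a (fun j => s j ^ 2) (fun j y => (hT j y).1)
  have hΘ := fun x =>
    (A.symm : EuclideanSpace ℝ (Fin M) →L[ℝ] EuclideanSpace ℝ (Fin M)).hasFDerivAt.comp x (hΨ x)
  have hinj : Function.Injective (A.symm ∘ Ψ) :=
    A.symm.injective.comp (injective_sum_comp_inner hspan ht fun j =>
      strictMono_of_hasDerivAt_pos (fun y => (hT j y).1) fun y => (hT j y).2.1)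
  have key := lintegral_det_mul_comp_le volume hΘ hinj
    fun x => ENNReal.ofReal (∏ j, gaussian 1 (s j) (inner ℝ (a j) x))
  rw [← ofReal_prod_toReal_eLpNorm gm, ← ofReal_prod_toReal_eLpNorm hm]
  refine le_trans ?_ (mul_le_mul_right key _)
  rw [productIntegral, ← lintegral_mul_const' _ _ ENNReal.ofReal_ne_top,
    ← lintegral_const_mul' _ _ ENNReal.ofReal_ne_top]
  refine lintegral_mono fun x => ?_
  have hprodh : 0 ≤ ∏ j, h j (inner ℝ (a j) x) := Finset.prod_nonneg fun j _ => (hpos j _).le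
  have hnormh : 0 ≤ ∏ j, (eLpNorm (h j) (p j)).toReal :=
    Finset.prod_nonneg fun j _ => ENNReal.toReal_nonneg
  dsimp only
  rw [← ENNReal.ofReal_mul hprodh, ← ENNReal.ofReal_mul (abs_nonneg _),
    ← ENNReal.ofReal_mul hnormh]
  refine ENNReal.ofReal_le_ofReal ?_
  have hdet : ∏ j, T' j (inner ℝ (a j) x) ^ (p j).toReal⁻¹ ≤
      |((A.symm : EuclideanSpace ℝ (Fin M) →L[ℝ] EuclideanSpace ℝ (Fin M)) ∘L
        frameOperator a fun j => s j ^ 2 * T' j (inner ℝ (a j) x)).det| := by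
    refine le_trans ?_ (le_abs_self _)
    have := det_frameOperator_mul_prod_le hspan hp hs hmax
      fun j => (hT j (inner ℝ (a j) x)).2.1
    rw [ContinuousLinearMap.det, ContinuousLinearMap.toLinearMap_comp, LinearMap.det_comp]
    change _ ≤ ContinuousLinearMap.det _ * ContinuousLinearMap.det _
    rw [hdetA, ← div_eq_inv_mul, le_div_iff₀ (det_frameOperator_pos hspan ht), mul_comm]
    exact this
  -- `A z = ∑ s_j² T_j a_j` at `z = A⁻¹ (Ψ x)`, so replacing `T_j` by `a_j · z` lowers the energy in
  -- the exponent.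
  have hgauss : ∏ j, gaussian 1 (s j) (T j (inner ℝ (a j) x)) ≤
      ∏ j, gaussian 1 (s j) (inner ℝ (a j) ((A.symm ∘ Ψ) x)) := by
    rw [prod_gaussian_one, prod_gaussian_one, Real.exp_le_exp]
    have := inner_frameOperator_le a (fun j => (ht j).le) (fun j => T j (inner ℝ (a j) x))
      (z := (A.symm ∘ Ψ) x) (by rw [← hA]; exact A.apply_symm_apply _)
    linarith
  rw [← Finset.prod_mul_distrib, Finset.prod_congr rfl fun j _ => (hT j (inner ℝ (a j) x)).2.2,
    Finset.prod_mul_distrib, Finset.prod_mul_distrib, mul_comm]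
  exact mul_le_mul_of_nonneg_left (mul_le_mul hdet hgauss
    (Finset.prod_nonneg fun j _ => (gaussian_pos one_pos _ _).le) (abs_nonneg _)) hnormh

/-! ### Reduction to continuous positive functions. -/

section Approximation

/-- Take the absolute value of a continuous approximant, which is no farther from `f ≥ 0`, and add a
small Gaussian for strict positivity. -/
theorem exists_continuous_pos_eLpNorm_sub_le {q : ℝ≥0∞} (hq : 1 ≤ q) (hq' : q ≠ ∞) {f : ℝ → ℝ}
    (hf : MemLp f q) (hf0 : ∀ y, 0 ≤ f y) {ε : ℝ≥0∞} (hε : ε ≠ 0) :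
    ∃ h : ℝ → ℝ, Continuous h ∧ MemLp h q ∧ (∀ y, 0 < h y) ∧ eLpNorm (h - f) q ≤ ε := by
  obtain ⟨g, -, hfg, gc, gm⟩ :=
    hf.exists_hasCompactSupport_eLpNorm_sub_le hq' (ENNReal.half_pos hε).ne'
  obtain ⟨c, hc, hc'⟩ := ENNReal.exists_nnreal_pos_mul_lt
    (memLp_gaussian 1 one_pos q).eLpNorm_ne_top (ENNReal.half_pos hε).ne'
  have hgm := memLp_gaussian c one_pos q
  refine ⟨|g| + gaussian c 1, gc.abs.add (continuous_gaussian _ _), gm.abs.add hgm,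
    fun y => add_pos_of_nonneg_of_pos (abs_nonneg _) (gaussian_pos hc 1 y), ?_⟩
  have h1 : eLpNorm (|g| - f) q ≤ ε / 2 := by
    refine le_trans (eLpNorm_mono fun y => ?_) hfg
    have := abs_abs_sub_abs_le (g y) (f y)
    rw [abs_of_nonneg (hf0 y), abs_sub_comm (g y)] at this
    exact this
  have h2 : eLpNorm (gaussian c 1) q ≤ ε / 2 := by
    have : gaussian c 1 = (c : ℝ) • gaussian 1 1 := by ext y; simp [gaussian]
    rw [this, eLpNorm_const_smul]
    refine le_of_eq_of_le ?_ hc'.le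
    simp
  have h3 := eLpNorm_add_le (gm.abs.sub hf).1 hgm.1 hq
  rw [add_sub_right_comm]
  exact h3.trans ((add_le_add h1 h2).trans_eq (ENNReal.add_halves ε))

theorem exists_seq_continuous_pos_tendsto_ae {q : ℝ≥0∞} (hq : 1 ≤ q) (hq' : q ≠ ∞) {f : ℝ → ℝ}
    (hf : MemLp f q) (hf0 : ∀ y, 0 ≤ f y) :
    ∃ h : ℕ → ℝ → ℝ, (∀ n, Continuous (h n) ∧ MemLp (h n) q ∧ (∀ y, 0 < h n y) ∧
      eLpNorm (h n) q ≤ eLpNorm f q + (n : ℝ≥0∞)⁻¹) ∧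
      ∀ᵐ y, Tendsto (fun n => h n y) atTop (𝓝 (f y)) := by
  -- The tolerance is `n⁻¹` in `ℝ≥0∞`; at `n = 0` it is `∞`, which is harmless.
  choose h hc hm hpos hε using fun n : ℕ => exists_continuous_pos_eLpNorm_sub_le hq hq' hf hf0
    (ENNReal.inv_ne_zero.2 (ENNReal.natCast_ne_top n))
  have hlim : Tendsto (fun n => eLpNorm (h n - f) q) atTop (𝓝 0) :=
    tendsto_of_tendsto_of_tendsto_of_le_of_le tendsto_const_nhds
      ENNReal.tendsto_inv_nat_nhds_zero (fun _ => zero_le) hε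
  obtain ⟨k, hk, hae⟩ := (tendstoInMeasure_of_tendsto_eLpNorm (one_pos.trans_le hq).ne'
    (fun n => (hm n).1) hf.1 hlim).exists_seq_tendsto_ae
  refine ⟨fun n => h (k n), fun n => ⟨hc _, hm _, hpos _, ?_⟩, hae⟩
  have h1 := eLpNorm_add_le hf.1 ((hm (k n)).sub hf).1 hq
  rw [add_sub_cancel] at h1
  refine h1.trans (add_le_add_right ((hε _).trans (ENNReal.inv_le_inv.2 ?_)) _)
  exact_mod_cast hk.id_le n

end Approximation

theorem bestConstant_le_gaussianConstant (ha : ∀ j, a j ≠ 0)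
    (hspan : Submodule.span ℝ (Set.range a) = ⊤) (hp : ∀ j, 1 ≤ p j)
    (hs : ∀ j, 0 < s j)
    (hmax : productIntegral a (fun j => gaussian 1 (s j)) =
      gaussianConstant a p * productNorm p (fun j => gaussian 1 (s j))) :
    bestConstant a p ≤ gaussianConstant a p := by
  have hp0 : ∀ j, p j ≠ 0 := fun j => (one_pos.trans_le (hp j)).ne'
  have hp' := exponent_ne_top_of_maximizer ha hspan hp0 hs hmax
  refine sSup_le ?_
  rintro r ⟨f, hf, rfl⟩
  have hf0 : productNorm p f ≠ 0 := productNorm_ne_zero fun j => (hf j).2.2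
  have hf1 : productNorm p f ≠ ∞ := productNorm_ne_top fun j => (hf j).2.1
  rw [ENNReal.div_le_iff_le_mul (.inl hf0) (.inl hf1)]
  choose h hh hae using fun j =>
    exists_seq_continuous_pos_tendsto_ae (hp j) (hp' j) (hf j).2.1 (hf j).1
  have hbound : ∀ n, productIntegral a (fun j => h j n) ≤
      gaussianConstant a p * ∏ j, (eLpNorm (f j) (p j) + (n : ℝ≥0∞)⁻¹) := fun n =>
    (productIntegral_le_of_continuous_of_pos hspan hp0 hp' hs hmax (fun j => (hh j n).1)
      (fun j => (hh j n).2.1) fun j => (hh j n).2.2.1).trans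
      (mul_le_mul_right (Finset.prod_le_prod' fun j _ => (hh j n).2.2.2) _)
  have hlim : Tendsto (fun n : ℕ => gaussianConstant a p *
      ∏ j, (eLpNorm (f j) (p j) + (n : ℝ≥0∞)⁻¹)) atTop
      (𝓝 (gaussianConstant a p * productNorm p f)) := by
    -- The limit of the products is nonzero, so finiteness of the constant need not be checked.
    refine ENNReal.Tendsto.const_mul ?_ (.inl hf0)
    refine ENNReal.tendsto_finsetProd_of_ne_top _ (fun j _ => ?_)
      fun j _ => (hf j).2.1.eLpNorm_ne_top
    have h1 := (tendsto_const_nhds (x := eLpNorm (f j) (p j))).add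
      ENNReal.tendsto_inv_nat_nhds_zero
    rwa [add_zero] at h1
  have hpt : ∀ᵐ x : EuclideanSpace ℝ (Fin M),
      Tendsto (fun n => ENNReal.ofReal (∏ j, h j n (inner ℝ (a j) x))) atTop
        (𝓝 (ENNReal.ofReal (∏ j, f j (inner ℝ (a j) x)))) := by
    filter_upwards [ae_all_iff.2 fun j => ae_inner_of_ae (ha j) (hae j)] with x hx
    exact ENNReal.tendsto_ofReal (tendsto_finsetProd _ fun j _ => hx j)
  have hfatou : productIntegral a f ≤
      liminf (fun n => productIntegral a fun j => h j n) atTop := by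
    refine (lintegral_congr_ae (hpt.mono fun x hx => hx.liminf_eq.symm)).trans_le
      (lintegral_liminf_le fun n => ?_)
    have := fun j => (hh j n).1
    fun_prop
  exact hfatou.trans ((liminf_le_liminf (.of_forall hbound)).trans_eq hlim.liminf_eq)

end BrascampLieb

end

theorem theorem3p1 {M N : ℕ} (a : Fin N → EuclideanSpace ℝ (Fin M))
    (ha : ∀ j, a j ≠ 0) (hspan : Submodule.span ℝ (Set.range a) = ⊤)
    (p : Fin N → ℝ≥0∞) (hp : ∀ j, 1 ≤ p j)
    (hmax : BrascampLieb.HasGaussianMaximizer a p) :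
    BrascampLieb.bestConstant a p = BrascampLieb.gaussianConstant a p := by
  obtain ⟨s, hs, hmax⟩ := hmax
  exact (BrascampLieb.bestConstant_le_gaussianConstant ha hspan hp hs hmax).antisymm
    (BrascampLieb.gaussianConstant_le_bestConstant a fun j => (one_pos.trans_le (hp j)).ne')
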